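/- Let $X$ be a connected simplicial set of dimension at most $1$ (a graph), with set of vertices $X_0$, and let $n_X$ be the number of free generators of its fundamental group $\pi_1(X)$. Let $N\mathbb Z_2$ be the nerve of $\mathbb Z_2$ (so $(N\mathbb Z_2)_n=\mathbb Z_2^n$), and for a simplicial set $Y$ let $D(Y)$ be the simplicial set with $D(Y)_n$ the set of finitely supported probability distributions on $Y_n$. For a simplicial set $Z$, let $\mathrm{sDist}(Z)$ be the convex set of simplicial maps $p\colon Z\to D(N\mathbb Z_2)$. An outcome assignment $s\colon Z\to N\mathbb Z_2$ gives the deterministic distribution $\delta^s\in\mathrm{sDist}(Z)$, $\delta^s_\sigma=\delta^{s_\sigma}$. A distribution $p\in\mathrm{sDist}(Z)$ is contextual if it is not of the form $p_\sigma=\sum_s d(s)\,\delta^{s_\sigma}$ for a finitely supported probability distribution $d$ on outcome assignments, and it is a vertex if it is an extreme point of $\mathrm{sDist}(Z)$. The product on $\mathrm{sDist}(Z)$ is $(p\cdot q)_\sigma^a=\sum_{b+c=a}p_\sigma^b\,q_\sigma^c$. Let $\mathrm{Cone}(Z)$ be the join of a point with $Z$. Then $\mathrm{sDist}(\mathrm{Cone}(X))$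 has at least $$(2^{n_X}-1)\,2^{|X_0|-1}$$ contextual vertices. Moreover, for every maximal tree $T\subset X$ with collapsing map $\pi\colon X\to X/T$ (the quotient that collapses $T$ to a point), at least this many contextual vertices of $\mathrm{sDist}(\mathrm{Cone}(X))$ have the form $\delta^s\cdot(\mathrm{Cone}\,\pi)^*(p)$, where $p$ is a contextual vertex of $\mathrm{sDist}(\mathrm{Cone}(X/T))$ and $s\colon\mathrm{Cone}(X)\to N\mathbb Z_2$ is an outcome assignment. (If $X$ is infinite, the numbers are read in $\mathbb N\cup\{\infty\}$.) -/

import Mathlib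

open CategoryTheory Opposite Convexity

universe u

noncomputable section

namespace SimplicialDist

/-! ### Distributions on a simplicial set -/

/-- The simplicial set `D(Y)` of distributions on `Y`: its `n`-simplices are the finitely supported
probability distributions on `Y_n`, its structure maps are the push-forwards along those of `Y`. -/
def distr (Y : SSet.{u}) : SSet.{u} where
  obj n := StdSimplex ℝ (Y.obj n)
  map f := ↾fun p => p.map (Y.map f)
  map_id n := by
    refine ConcreteCategory.hom_ext _ _ fun (p : StdSimplex ℝ (Y.obj n)) => ?_
    change p.map (Y.map (𝟙 n)) = p
    conv_rhs => rw [← StdSimplex.map_id p]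
    congr 1
    funext x
    simp
  map_comp f g := by
    refine ConcreteCategory.hom_ext _ _ fun (p : StdSimplex ℝ (Y.obj _)) => ?_
    change p.map (Y.map (f ≫ g)) = (p.map (Y.map f)).map (Y.map g)
    rw [StdSimplex.map_map]
    congr 1
    funext x
    simp

/-! ### The outcome space -/

/-- The group `ℤ/2` (in the universe `u`). -/
abbrev Z2 : Type u := ULift.{u} (ZMod 2)

theorem sum_block_sub {A : Type*} [AddCommGroup A] {n : ℕ} (a : Fin n → A) {x y : ℕ}
    (hxy : x ≤ y) :
    ∑ j : Fin n with x ≤ j.val ∧ j.val < y, a j =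
      (∑ j : Fin n with j.val < y, a j) - ∑ j : Fin n with j.val < x, a j := by
  rw [eq_sub_iff_add_eq, ← Finset.sum_union]
  · congr 1
    ext j
    simp only [Finset.mem_union, Finset.mem_filter, Finset.mem_univ, true_and]
    omega
  · rw [Finset.disjoint_filter]
    intro j _ h
    omega

theorem sum_block_telescope {A : Type*} [AddCommGroup A] (F : ℕ → A) {m x y : ℕ}
    (hxy : x ≤ y) (hy : y ≤ m) :
    ∑ k : Fin m with x ≤ k.val ∧ k.val < y, (F (k.val + 1) - F k.val) = F y - F x := by
  rw [← Finset.sum_Ico_sub F hxy]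
  refine Finset.sum_bij (fun k _ => k.val) ?_ ?_ ?_ ?_
  · intro k hk
    simpa using hk
  · intro k _ l _ h
    exact Fin.ext h
  · intro k hk
    rw [Finset.mem_Ico] at hk
    exact ⟨⟨k, by omega⟩, by simpa using hk, rfl⟩
  · intro k _
    rfl

/-- The structure maps of the nerve of an abelian group: the `i`-th entry of `θ^*(a_1, …, a_n)` is
the sum of the entries `a_j` with `θ(i-1) < j ≤ θ(i)` (the entries are indexed from `0` here). -/
def nerveStr {A : Type u} [AddCommGroup A] {m n : SimplexCategory} (θ : m ⟶ n)
    (a : Fin n.len → A) : Fin m.len → A := fun i =>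
  ∑ j : Fin n.len with (θ i.castSucc).val ≤ j.val ∧ j.val < (θ i.succ).val, a j

/-- The nerve space `N ℤ/2`, with `n`-simplices `(ℤ/2)^n`. -/
def NZ2 : SSet.{u} where
  obj n := Fin n.unop.len → Z2.{u}
  map f := ↾fun a => nerveStr f.unop a
  map_id n := by
    refine ConcreteCategory.hom_ext _ _ fun a => funext fun i => ?_
    change nerveStr (𝟙 n.unop) a i = a i
    have : (Finset.univ.filter fun j : Fin n.unop.len =>
        ((𝟙 n.unop : n.unop ⟶ n.unop) i.castSucc).val ≤ j.val ∧
          j.val < ((𝟙 n.unop : n.unop ⟶ n.unop) i.succ).val) = {i} := by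
      ext j
      simp [Fin.ext_iff]
      omega
    rw [nerveStr, this, Finset.sum_singleton]
  map_comp {l m n} f g := by
    refine ConcreteCategory.hom_ext _ _ fun a => funext fun i => ?_
    change nerveStr (g.unop ≫ f.unop) a i = nerveStr g.unop (nerveStr f.unop a) i
    generalize f.unop = θ, g.unop = φ
    have mono : ∀ {p q : SimplexCategory} (χ : p ⟶ q) (i : Fin p.len),
        (χ i.castSucc).val ≤ (χ i.succ).val := fun χ i =>
      χ.toOrderHom.monotone (by simp [Fin.le_iff_val_le_val])
    let F : ℕ → Z2.{u} := fun k => if h : k < m.unop.len + 1 then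
      ∑ j : Fin l.unop.len with j.val < (θ ⟨k, h⟩).val, a j else 0
    have key : ∀ k : Fin m.unop.len, nerveStr θ a k = F (k.val + 1) - F k.val := by
      intro k
      rw [nerveStr, sum_block_sub a (mono θ k)]
      have h1 : k.val + 1 < m.unop.len + 1 := by omega
      have h2 : k.val < m.unop.len + 1 := by omega
      simp only [F, dif_pos h1, dif_pos h2]
      rfl
    have hF : ∀ v : Fin (m.unop.len + 1),
        F v.val = ∑ j : Fin l.unop.len with j.val < (θ v).val, a j := by
      intro v
      simp only [F, dif_pos v.2]
    rw [nerveStr, nerveStr, sum_block_sub a (mono (φ ≫ θ) i)]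
    simp only [key]
    rw [sum_block_telescope F (mono φ i) (by omega), hF, hF]
    rfl

/-! ### Simplicial distributions -/

/-- Simplicial distributions on `X` with outcomes in `N ℤ/2`. -/
abbrev SDist (X : SSet.{u}) : Type u := X ⟶ distr NZ2.{u}

/-- The deterministic distribution `δ^s` of an outcome assignment `s`. -/
def det {X : SSet.{u}} (s : X ⟶ NZ2.{u}) : SDist X where
  app n := ↾fun σ => StdSimplex.single (s.app n σ)
  naturality m n f := by
    ext σ
    change StdSimplex.single (s.app n (X.map f σ)) =
      (StdSimplex.single (s.app m σ)).map (NZ2.map f)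
    rw [StdSimplex.map_single]
    exact congrArg _ (NatTrans.naturality_apply s f σ)

/-- The map `Θ`, sending a distribution `d` on outcome assignments (equivalently, on deterministic
distributions) to the simplicial distribution `σ ↦ ∑ₛ d(s) δ^{s_σ}`. -/
def theta {X : SSet.{u}} (d : StdSimplex ℝ (X ⟶ NZ2.{u})) : SDist X where
  app n := ↾fun σ => d.map fun s => s.app n σ
  naturality m n f := by
    ext σ
    change (d.map fun s => s.app n (X.map f σ)) = (d.map fun s => s.app m σ).map (NZ2.map f)
    rw [StdSimplex.map_map]
    congr 1
    funext s
    exact NatTrans.naturality_apply s f σ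

/-- A simplicial distribution is contextual if it is not in the image of `Θ`. -/
def IsContextual {X : SSet.{u}} (p : SDist X) : Prop := p ∉ Set.range (theta (X := X))

/-- The probability coordinates `p_σ^a` of a simplicial distribution. -/
def coords {X : SSet.{u}} (p : SDist X) : (n : ℕ) → X.obj (op (.mk n)) → NZ2.{u}.obj (op (.mk n)) → ℝ :=
  fun n σ a => (show StdSimplex ℝ (NZ2.{u}.obj (op (.mk n))) from p.app (op (SimplexCategory.mk n)) σ).weights a

/-- A vertex of `sDist(X)`: an extreme point of the convex set of simplicial distributions. -/
def IsVertex {X : SSet.{u}} (p : SDist X) : Prop :=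
  coords p ∈ Set.extremePoints ℝ (Set.range (coords (X := X)))

/-- The set of contextual vertices of `sDist(X)`. -/
def contextualVertices (X : SSet.{u}) : Set (SDist X) := {p | IsVertex p ∧ IsContextual p}

/-- The map `f^* : sDist(X) → sDist(Z)` induced by `f : Z → X`. -/
def pullback {Z X : SSet.{u}} (f : Z ⟶ X) (p : SDist X) : SDist Z := f ≫ p

/-! ### The product of simplicial distributions -/

/-- The convolution `(p · q)(a) = ∑_{b + c = a} p(b) q(c)` of distributions on an abelian group. -/
def conv {A : Type*} [AddCommGroup A] (p q : StdSimplex ℝ A) : StdSimplex ℝ A :=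
  p.iConvexComb fun b => q.map fun c => b + c

theorem map_conv {A B : Type*} [AddCommGroup A] [AddCommGroup B] (f : A → B)
    (hf : ∀ b c, f (b + c) = f b + f c) (p q : StdSimplex ℝ A) :
    (conv p q).map f = conv (p.map f) (q.map f) := by
  simp only [conv, iConvexComb, StdSimplex.map_sConvexComb, StdSimplex.map_map, hf]

instance (n : SimplexCategoryᵒᵖ) : AddCommGroup (NZ2.{u}.obj n) :=
  inferInstanceAs (AddCommGroup (Fin n.unop.len → Z2.{u}))

theorem NZ2_map_add {m n : SimplexCategoryᵒᵖ} (f : m ⟶ n) (b c : NZ2.{u}.obj m) :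
    NZ2.map f (b + c) = NZ2.map f b + NZ2.map f c := by
  funext i
  exact Finset.sum_add_distrib (M := Z2.{u}) (s := Finset.univ.filter _) (f := b) (g := c)

/-- The product `p · q` of simplicial distributions. -/
def mul {X : SSet.{u}} (p q : SDist X) : SDist X where
  app n := ↾fun σ => conv (A := NZ2.{u}.obj n) (p.app n σ) (q.app n σ)
  naturality m n f := by
    ext σ
    change conv (A := NZ2.{u}.obj n) (p.app n (X.map f σ)) (q.app n (X.map f σ)) =
      (conv (A := NZ2.{u}.obj m) (p.app m σ) (q.app m σ)).map (NZ2.map f)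
    refine Eq.trans ?_ (map_conv _ (NZ2_map_add f) _ _).symm
    exact congrArg₂ (conv (A := NZ2.{u}.obj n)) (NatTrans.naturality_apply p f σ)
      (NatTrans.naturality_apply q f σ)

/-! ### The cone -/

/-- The `n`-simplices of the cone: the degenerate simplex `c_n` of the apex, and the simplices
`(c_k, σ)` with `σ ∈ X_l` and `k + 1 + l = n`. The case `l = n` gives the simplices `σ ∈ X_n` of the
base: the first `n - l` vertices of `join l h σ` are at the apex, the last `l + 1` are those
of `σ`. -/
inductive ConeSimplex (X : SSet.{u}) (n : ℕ) : Type u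
  | apex
  | join (l : ℕ) (h : l ≤ n) (σ : X.obj (op (.mk l)))

/-- The number of vertices that `θ` sends to the last `l + 1` vertices of `[n]`. -/
def baseCount {m n : SimplexCategory} (θ : m ⟶ n) (l : ℕ) : ℕ :=
  (Finset.univ.filter fun i : Fin (m.len + 1) => n.len - l ≤ (θ i).val).card

theorem baseCount_le {m n : SimplexCategory} (θ : m ⟶ n) (l : ℕ) : baseCount θ l ≤ m.len + 1 :=
  (Finset.card_filter_le _ _).trans (by simp)

theorem le_iff_baseCount {m n : SimplexCategory} (θ : m ⟶ n) (l : ℕ) (i : Fin (m.len + 1)) :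
    n.len - l ≤ (θ i).val ↔ m.len + 1 - baseCount θ l ≤ i.val := by
  have mono : ∀ {i j : Fin (m.len + 1)}, i ≤ j → (θ i).val ≤ (θ j).val := fun h =>
    θ.toOrderHom.monotone h
  have hle := baseCount_le θ l
  constructor
  · intro hi
    have hsub : Finset.Ici i ⊆
        Finset.univ.filter fun i : Fin (m.len + 1) => n.len - l ≤ (θ i).val := by
      intro j hj
      rw [Finset.mem_Ici] at hj
      simpa using hi.trans (mono hj)
    have := Finset.card_le_card hsub
    rw [Fin.card_Ici] at this
    change _ ≤ baseCount θ l at this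
    omega
  · intro hi
    by_contra hc
    have hsub : (Finset.univ.filter fun i : Fin (m.len + 1) => n.len - l ≤ (θ i).val) ⊆
        Finset.Ioi i := by
      intro j hj
      rw [Finset.mem_Ioi]
      by_contra hj'
      simp only [Finset.mem_filter, Finset.mem_univ, true_and] at hj
      exact hc (hj.trans (mono (not_lt.1 hj')))
    have := Finset.card_le_card hsub
    rw [Fin.card_Ioi] at this
    change baseCount θ l ≤ _ at this
    omega

/-- The restriction of `θ : [m] → [n]` to the vertices that it sends to the last `l + 1` vertices
of `[n]`. -/
def baseMap {m n : SimplexCategory} (θ : m ⟶ n) (l : ℕ) (hl : l ≤ n.len)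
    (h : baseCount θ l ≠ 0) : SimplexCategory.mk (baseCount θ l - 1) ⟶ .mk l :=
  SimplexCategory.mkHom
    { toFun := fun i => ⟨(θ ⟨i.val + (m.len + 1 - baseCount θ l), by
          have h₁ : i.val < baseCount θ l - 1 + 1 := i.2
          have h₂ := baseCount_le θ l
          omega⟩).val - (n.len - l), by
          have h₁ : i.val < baseCount θ l - 1 + 1 := i.2
          have h₂ := baseCount_le θ l
          have h₃ := (θ ⟨i.val + (m.len + 1 - baseCount θ l), by omega⟩).2
          change _ < l + 1
          omega⟩
      monotone' := fun i j hij => by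
        refine Fin.mk_le_mk.2 (Nat.sub_le_sub_right ?_ _)
        refine θ.toOrderHom.monotone (Fin.mk_le_mk.2 ?_)
        exact Nat.add_le_add_right hij _ }

/-- The structure maps of the cone. -/
def coneStr (X : SSet.{u}) {m n : SimplexCategory} (θ : m ⟶ n) :
    ConeSimplex X n.len → ConeSimplex X m.len
  | .apex => .apex
  | .join l h σ =>
    if hK : baseCount θ l = 0 then .apex
    else .join (baseCount θ l - 1) (by have := baseCount_le θ l; omega)
      (X.map (baseMap θ l h hK).op σ)

theorem join_congr {X : SSet.{u}} {n l l₁ l₂ : ℕ} (hl : l₁ = l₂) {h₁ : l₁ ≤ n} {h₂ : l₂ ≤ n}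
    (σ : X.obj (op (.mk l))) (f₁ : SimplexCategory.mk l₁ ⟶ .mk l) (f₂ : SimplexCategory.mk l₂ ⟶ .mk l)
    (hf : ∀ (i : ℕ) (h : i < l₁ + 1) (h' : i < l₂ + 1),
      (f₁ ⟨i, h⟩).val = (f₂ ⟨i, h'⟩).val) :
    (ConeSimplex.join l₁ h₁ (X.map f₁.op σ) : ConeSimplex X n) =
      ConeSimplex.join l₂ h₂ (X.map f₂.op σ) := by
  subst hl
  have : f₁ = f₂ := by
    ext i
    exact hf i.val i.2 i.2
  rw [this]

theorem baseCount_id (n : SimplexCategory) (l : ℕ) (h : l ≤ n.len) :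
    baseCount (𝟙 n) l = l + 1 := by
  have h0 := baseCount_le (𝟙 n) l
  have hn := le_iff_baseCount (𝟙 n) l
  have e : ∀ i : Fin (n.len + 1), ((𝟙 n : n ⟶ n) i) = i := fun i => rfl
  simp only [e] at hn
  have h1 := (hn ⟨n.len - l, by omega⟩).1 le_rfl
  simp only at h1
  by_contra hne
  have h2 := (hn ⟨n.len + 1 - baseCount (𝟙 n) l, by omega⟩).2 le_rfl
  simp only at h2
  omega

theorem baseCount_comp {k m n : SimplexCategory} (φ : k ⟶ m) (θ : m ⟶ n) (l : ℕ) :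
    baseCount (φ ≫ θ) l =
      if baseCount θ l = 0 then 0 else baseCount φ (baseCount θ l - 1) := by
  have h0 := baseCount_le θ l
  have hiff : ∀ i : Fin (k.len + 1), n.len - l ≤ ((φ ≫ θ) i).val ↔
      m.len + 1 - baseCount θ l ≤ (φ i).val := fun i => le_iff_baseCount θ l (φ i)
  split_ifs with h
  · rw [baseCount, Finset.card_eq_zero, Finset.filter_eq_empty_iff]
    intro i _
    rw [hiff, h]
    have := (φ i).2
    omega
  · rw [baseCount, baseCount]
    congr 1
    ext i
    simp only [Finset.mem_filter, Finset.mem_univ, true_and]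
    rw [hiff]
    omega

/-- The cone of a simplicial set. -/
def cone (X : SSet.{u}) : SSet.{u} where
  obj n := ConeSimplex X n.unop.len
  map f := ↾(coneStr X f.unop)
  map_id n := by
    ext x
    change coneStr X (𝟙 n.unop) x = x
    cases x with
    | apex => rfl
    | join l h σ =>
      have hc := baseCount_id n.unop l h
      rw [coneStr, dif_neg (by omega)]
      conv_rhs => rw [show σ = X.map (𝟙 (SimplexCategory.mk l)).op σ by simp]
      refine join_congr (by omega) σ _ _ ?_
      intro i h₁ h₂
      change i + (n.unop.len + 1 - baseCount (𝟙 n.unop) l) - (n.unop.len - l) = i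
      omega
  map_comp {a b c} f g := by
    ext x
    change coneStr X (g.unop ≫ f.unop) x = coneStr X g.unop (coneStr X f.unop x)
    generalize f.unop = θ, g.unop = φ
    cases x with
    | apex => rfl
    | join l h σ =>
      have hc := baseCount_comp φ θ l
      have hb := baseCount_le θ l
      by_cases h1 : baseCount θ l = 0
      · rw [if_pos h1] at hc
        simp only [coneStr, dif_pos hc, dif_pos h1]
      · rw [if_neg h1] at hc
        by_cases h2 : baseCount φ (baseCount θ l - 1) = 0
        · rw [h2] at hc
          simp only [coneStr, dif_pos hc, dif_neg h1, dif_pos h2]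
        · have h3 : baseCount (φ ≫ θ) l ≠ 0 := by omega
          simp only [coneStr, dif_neg h3, dif_neg h1, dif_neg h2]
          rw [← Functor.map_comp_apply, ← op_comp]
          refine join_congr (by omega) σ _ _ ?_
          intro i h₁ h₂
          have hd := baseCount_le φ (baseCount θ l - 1)
          have hv := (le_iff_baseCount φ (baseCount θ l - 1)
            ⟨i + (c.unop.len + 1 - baseCount φ (baseCount θ l - 1)), by omega⟩).2
            (by simp only; omega)
          change (θ (φ ⟨i + (c.unop.len + 1 - baseCount (φ ≫ θ) l), _⟩)).val - (a.unop.len - l) =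
            (θ ⟨(φ ⟨i + (c.unop.len + 1 - baseCount φ (baseCount θ l - 1)), _⟩).val -
              (b.unop.len - (baseCount θ l - 1)) + (b.unop.len + 1 - baseCount θ l), _⟩).val -
              (a.unop.len - l)
          congr 3
          apply Fin.ext
          simp only [hc]
          omega

/-- The map `Cone(f) : Cone(X) → Cone(Y)` induced by `f : X → Y`. -/
def coneMap {X Y : SSet.{u}} (f : X ⟶ Y) : cone X ⟶ cone Y where
  app n := ↾fun x => match x with
    | .apex => .apex
    | .join l h σ => .join l h (f.app _ σ)
  naturality m n g := by
    ext x
    cases x with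
    | apex => rfl
    | join l h σ =>
      change (match coneStr X g.unop (.join l h σ) with
        | .apex => (.apex : ConeSimplex Y n.unop.len)
        | .join l h σ => .join l h (f.app _ σ)) = coneStr Y g.unop (.join l h (f.app _ σ))
      by_cases h1 : baseCount g.unop l = 0
      · simp only [coneStr, dif_pos h1]
      · simp only [coneStr, dif_neg h1]
        congr 1
        exact NatTrans.naturality_apply f _ σ

/-! ### Graphs, their fundamental group and maximal trees -/

/-- The vertices of a simplicial set, as the vertices of the directed graph whose arrows are the
non-degenerate `1`-simplices. -/
def Graph (X : SSet.{u}) : Type u := X.obj (op (.mk 0))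

instance (X : SSet.{u}) : Quiver.{u} (Graph X) where
  Hom v w := {e : X.obj (op (.mk 1)) // e ∈ X.nonDegenerate 1 ∧ X.δ 1 e = v ∧ X.δ 0 e = w}

/-- The fundamental groupoid of a `1`-dimensional simplicial set: the groupoid of edge paths up to
cancellation, that is, the free groupoid on the graph. -/
abbrev FundGroupoid (X : SSet.{u}) : Type u := Quiver.FreeGroupoid (Graph X)

/-- A vertex as an object of the fundamental groupoid. -/
def vert {X : SSet.{u}} (x : X.obj (op (.mk 0))) : FundGroupoid X :=
  (Quiver.FreeGroupoid.of (Graph X)).obj x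

/-- The fundamental group `π₁(X, x)` of a `1`-dimensional simplicial set. -/
abbrev FundGroup (X : SSet.{u}) (x : X.obj (op (.mk 0))) : Type u := End (vert x)

instance (V : Type u) [Quiver.{u} V] : IsFreeGroupoid (Quiver.FreeGroupoid V) where
  quiverGenerators := ⟨fun a b => @Quiver.Hom V _ a.as b.as⟩
  of {a b} e := (Quiver.FreeGroupoid.of V).map (X := a.as) (Y := b.as) e
  unique_lift {G} _ f := by
    let φ : V ⥤q SingleObj G :=
      { obj := fun _ => SingleObj.star G
        map := fun {v w} e => @f ⟨v⟩ ⟨w⟩ e }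
    refine ⟨Quiver.FreeGroupoid.lift φ, ?_, ?_⟩
    · rintro ⟨v⟩ ⟨w⟩ e
      have h := Quiver.FreeGroupoid.lift_spec φ
      exact eq_of_heq (by
        have := congr_arg_heq (fun ψ : V ⥤q SingleObj G => ψ.map (X := v) (Y := w) e) h
        exact this)
    · intro F hF
      refine Quiver.FreeGroupoid.lift_unique φ F ?_
      refine Prefunctor.ext (fun _ => rfl) fun v w e => ?_
      exact hF ⟨v⟩ ⟨w⟩ e

theorem nonempty_hom_of_edge {X : SSet.{u}} (e : X.obj (op (.mk 1))) :
    Nonempty (vert (X.δ 1 e) ⟶ vert (X.δ 0 e)) := by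
  by_cases he : e ∈ X.nonDegenerate 1
  · exact ⟨(Quiver.FreeGroupoid.of (Graph X)).map
      (⟨e, he, rfl, rfl⟩ : @Quiver.Hom (Graph X) _ (X.δ 1 e) (X.δ 0 e))⟩
  · have he' : e ∈ X.degenerate 1 := by simpa [SSet.nonDegenerate] using he
    rw [SSet.degenerate_eq_iUnion_range_σ] at he'
    obtain ⟨i, y, rfl⟩ := Set.mem_iUnion.1 he'
    obtain rfl : i = 0 := Fin.eq_zero i
    have h0 : X.δ 0 (X.σ 0 y) = y := by
      exact SSet.δ_comp_σ_self_apply 0 y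
    have h1 : X.δ 1 (X.σ 0 y) = y := by
      exact SSet.δ_comp_σ_succ_apply 0 y
    exact ⟨eqToHom (by rw [h0, h1])⟩

instance (X : SSet.{u}) [X.IsConnected] : IsConnected (FundGroupoid X) := by
  have key : ∀ v w : X.obj (op (.mk 0)), Nonempty (vert v ⟶ vert w) := by
    intro v w
    have h := (SSet.π₀.mk_eq_mk_iff v w).1 (Subsingleton.elim _ _)
    induction h with
    | rel x y h =>
      obtain ⟨e⟩ := h
      have := nonempty_hom_of_edge e.edge
      rwa [e.src_eq, e.tgt_eq] at this
    | refl x => exact ⟨𝟙 _⟩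
    | symm x y _ ih => exact ih.map fun f => Groupoid.inv f
    | trans x y z _ _ ih₁ ih₂ =>
      obtain ⟨f⟩ := ih₁
      obtain ⟨g⟩ := ih₂
      exact ⟨f ≫ g⟩
  have : Nonempty (FundGroupoid X) := ⟨vert (Classical.arbitrary (X.obj (op (.mk 0))))⟩
  refine zigzag_isConnected ?_
  rintro ⟨v⟩ ⟨w⟩
  obtain ⟨f⟩ := key v w
  exact Zigzag.of_hom f

/-- The number `n_X` of generators of the fundamental group of a connected graph, which is a free
group. -/
def numGenerators (X : SSet.{u}) [X.IsConnected] (x : X.obj (op (.mk 0))) : ℕ∞ :=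
  ENat.card (IsFreeGroup.Generators (FundGroup X x))

/-- A tree: a connected `1`-dimensional simplicial set with trivial fundamental group. -/
structure IsTree (T : SSet.{u}) : Prop where
  dim : T.HasDimensionLE 1
  connected : T.IsConnected
  trivial : ∀ x : T.obj (op (.mk 0)), Subsingleton (FundGroup T x)

/-- A maximal tree: a tree in `X` that contains all vertices of `X`. -/
def IsMaximalTree {X : SSet.{u}} (T : X.Subcomplex) : Prop :=
  IsTree (T : SSet.{u}) ∧ ∀ v : X.obj (op (.mk 0)), v ∈ T.obj (op (SimplexCategory.mk 0))

/-! ### Collapsing a simplicial subset -/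

/-- The quotient `X/T`, in which all `n`-simplices of `T` become one, for each `n`. -/
def collapse {X : SSet.{u}} (T : X.Subcomplex) : SSet.{u} where
  obj n := Quot fun a b : X.obj n => a ∈ T.obj n ∧ b ∈ T.obj n
  map f := ↾(Quot.map (X.map f) fun _ _ h => ⟨T.map f h.1, T.map f h.2⟩)
  map_id _ := by
    ext x
    induction x using Quot.ind with
    | mk a => exact congrArg (Quot.mk _) (by simp)
  map_comp f g := by
    ext x
    induction x using Quot.ind with
    | mk a => exact congrArg (Quot.mk _) (by simp)

/-- The collapsing map `π : X → X/T`. -/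
def collapseMap {X : SSet.{u}} (T : X.Subcomplex) : X ⟶ collapse T where
  app _ := ↾(Quot.mk _)
  naturality _ _ _ := rfl

end SimplicialDist

end

/-! An outcome assignment `f` on `X` is a mod 2 cocycle. An assignment on the cone is fixed by its
values `t` on the edges from the apex, and on the base it restricts to the coboundary `dt`. So an
`f` that is not a coboundary has no extension to the cone. Over one simplex that has apex and base
vertices it still has exactly two extensions, exchanged by adding a constant to all apex edges.
Mixing the two with weights 1/2 is compatible with all structure maps and gives `prDist f`.

It is contextual (`isContextual_prDist`): an assignment of positive weight in a decomposition would
extend `f`. It is a vertex (`isVertex_prDist`): in a distribution with no larger support, the bias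
between 0 and 1 on the apex edges is transported along each edge of `X` with the sign given by `f`.
By connectedness a nonzero bias is nonzero everywhere, and its sign would write `f` as a coboundary.
So the bias is zero and the distribution is `prDist f`.

It remains to count cocycles, since `f` is the restriction of `prDist f` to the base. After a choice
of paths from `x`, a homomorphism `φ` from the fundamental group to ℤ/2 labels the edges, and on a
graph any labelling that is zero on degenerate edges is a cocycle (`ofCochain`). The cocycles `f_φ +
dt` with `φ ≠ 1` and `t x = 0` are pairwise distinct non-coboundaries (`eq_and_eq_of_label_eq`), and
freeness of the group gives their number.

If the paths are chosen in a maximal tree `T`, then `f_φ` vanishes on `T` and descends to `X/T`.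
Adding `dt` is multiplication by a deterministic distribution (`mul_det_prDist`), which gives the
required product form. -/

noncomputable section

namespace SimplicialDist

/-! ### Vectors of the nerve as increments of functions on vertices -/

section Increments

variable {A : Type*} [AddCommGroup A]

/-- The increments of a function on the vertices of `[n]`. -/
def incr {n : ℕ} (F : Fin (n + 1) → A) : Fin n → A := fun i => F i.succ - F i.castSucc

/-- The partial sums of a vector. -/
def partialSum {n : ℕ} (a : Fin n → A) (j : Fin (n + 1)) : A :=
  ∑ i : Fin n with i.val < j.val, a i

@[simp]
theorem partialSum_zero {n : ℕ} (a : Fin n → A) : partialSum a 0 = 0 := by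
  simp [partialSum]

theorem partialSum_add {n : ℕ} (a b : Fin n → A) (j : Fin (n + 1)) :
    partialSum (a + b) j = partialSum a j + partialSum b j :=
  Finset.sum_add_distrib

theorem incr_partialSum {n : ℕ} (a : Fin n → A) : incr (partialSum a) = a := by
  funext i
  have h := sum_block_sub a (x := i.val) (y := i.val + 1) (by omega)
  have e : (Finset.univ.filter fun j : Fin n => i.val ≤ j.val ∧ j.val < i.val + 1) = {i} := by
    ext j
    simp [Fin.ext_iff]
    omega
  rw [e, Finset.sum_singleton] at h
  exact h.symm

theorem sum_block_incr {n : ℕ} (F : Fin (n + 1) → A) {x y : Fin (n + 1)} (hxy : x ≤ y) :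
    ∑ k : Fin n with x.val ≤ k.val ∧ k.val < y.val, incr F k = F y - F x := by
  let G : ℕ → A := fun k => if h : k < n + 1 then F ⟨k, h⟩ else 0
  have hG : ∀ k : Fin (n + 1), G k.val = F k := fun k => dif_pos k.2
  rw [← hG, ← hG, ← sum_block_telescope (m := n) G hxy (Nat.lt_succ_iff.1 y.2)]
  refine Finset.sum_congr rfl fun k _ => ?_
  rw [incr, ← hG, ← hG]
  rfl

theorem partialSum_incr {n : ℕ} (F : Fin (n + 1) → A) (j : Fin (n + 1)) :
    partialSum (incr F) j = F j - F 0 := by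
  rw [← sum_block_incr F (Fin.zero_le j), partialSum]
  simp

theorem incr_add_const {n : ℕ} (F : Fin (n + 1) → A) (c : A) : incr (fun j => c + F j) = incr F := by
  funext i
  simp [incr]

theorem incr_add {n : ℕ} (F G : Fin (n + 1) → A) :
    incr (fun j => F j + G j) = incr F + incr G := by
  funext i
  simp only [incr, Pi.add_apply]
  abel

end Increments

/-- An `n`-simplex of the nerve is a function on the vertices of `[n]` up to a constant; in these
terms the structure maps are precomposition, because block sums of increments telescope. -/
theorem nerveStr_incr {A : Type u} [AddCommGroup A] {m n : SimplexCategory} (θ : m ⟶ n)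
    (F : Fin (n.len + 1) → A) : nerveStr θ (incr F) = incr fun j => F (θ j) := by
  funext i
  exact sum_block_incr F (θ.toOrderHom.monotone (by simp [Fin.le_iff_val_le_val]))

theorem partialSum_nerveStr {A : Type u} [AddCommGroup A] {m n : SimplexCategory} (θ : m ⟶ n)
    (a : Fin n.len → A) (j : Fin (m.len + 1)) :
    partialSum (nerveStr θ a) j = partialSum a (θ j) - partialSum a (θ 0) := by
  conv_lhs => rw [← incr_partialSum a, nerveStr_incr, partialSum_incr]

/-- Extension by zero to the vertices of `[n]` of a function on the last `l + 1` of them. -/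
def extendZero {A : Type*} [Zero A] {l : ℕ} (n : ℕ) (hl : l ≤ n) (G : Fin (l + 1) → A) :
    Fin (n + 1) → A :=
  fun j => if n - l ≤ j.val then G ⟨j.val - (n - l), by omega⟩ else 0

/-- The vertices that `θ` sends into the base part form a final segment, on which `baseMap` is `θ`
reindexed. -/
theorem extendZero_comp {A : Type*} [Zero A] {m n : SimplexCategory} (θ : m ⟶ n) {l : ℕ}
    (hl : l ≤ n.len) (G : Fin (l + 1) → A) (hK : baseCount θ l ≠ 0) :
    (fun j => extendZero n.len hl G (θ j)) =
      extendZero (l := baseCount θ l - 1) m.len (by have := baseCount_le θ l; omega)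
        fun j => G (baseMap θ l hl hK j) := by
  have hc := baseCount_le θ l
  funext j
  have h := le_iff_baseCount θ l j
  have e : m.len - (baseCount θ l - 1) = m.len + 1 - baseCount θ l := by omega
  by_cases hj : n.len - l ≤ (θ j).val
  · have hj' := h.1 hj
    simp only [extendZero, if_pos hj, e, if_pos hj']
    congr 1
    apply Fin.ext
    change (θ j).val - (n.len - l) =
      (θ ⟨j.val - (m.len + 1 - baseCount θ l) + (m.len + 1 - baseCount θ l), _⟩).val - (n.len - l)
    congr 3
    apply Fin.ext
    simp only
    omega
  · have hj' := fun h' => hj (h.2 h')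
    simp only [extendZero, if_neg hj, e, if_neg hj']

theorem extendZero_comp_of_eq_zero {A : Type*} [Zero A] {m n : SimplexCategory} (θ : m ⟶ n) {l : ℕ}
    (hl : l ≤ n.len) (G : Fin (l + 1) → A) (hK : baseCount θ l = 0) (j : Fin (m.len + 1)) :
    extendZero n.len hl G (θ j) = 0 := by
  refine if_neg fun h => ?_
  rw [le_iff_baseCount, hK] at h
  omega

@[simp]
theorem incr_zero {A : Type*} [AddCommGroup A] {n : ℕ} :
    incr (fun _ : Fin (n + 1) => (0 : A)) = 0 := by
  funext i
  simp [incr]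

/-! ### Assignments on the cone that are determined up to a shift -/

/-- The sum of the values of `f` along the first `j` edges of the spine of `σ`. -/
def spineSum {Y : SSet.{u}} (f : Y ⟶ NZ2.{u}) {n : SimplexCategory} (σ : Y.obj (op n))
    (j : Fin (n.len + 1)) : Z2.{u} :=
  partialSum (A := Z2.{u}) (n := n.len) (f.app (op n) σ) j

@[simp]
theorem spineSum_zero {Y : SSet.{u}} (f : Y ⟶ NZ2.{u}) {n : SimplexCategory} (σ : Y.obj (op n)) :
    spineSum f σ 0 = 0 :=
  partialSum_zero _

theorem incr_spineSum {Y : SSet.{u}} (f : Y ⟶ NZ2.{u}) {n : SimplexCategory} (σ : Y.obj (op n)) :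
    incr (spineSum f σ) = f.app (op n) σ :=
  incr_partialSum _

theorem spineSum_map {Y : SSet.{u}} (f : Y ⟶ NZ2.{u}) {m n : SimplexCategory} (θ : m ⟶ n)
    (σ : Y.obj (op n)) (j : Fin (m.len + 1)) :
    spineSum f (Y.map θ.op σ) j = spineSum f σ (θ j) - spineSum f σ (θ 0) := by
  have e : (show Fin m.len → Z2.{u} from f.app (op m) (Y.map θ.op σ)) =
      nerveStr θ (f.app (op n) σ) := NatTrans.naturality_apply f θ.op σ
  exact (congrArg (fun a => partialSum a j) e).trans (partialSum_nerveStr θ _ j)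

/-- The value at a simplex of the cone over `Y` of the assignment that restricts to `f` on `Y` and
takes the value `a` on the edge from the apex to the first vertex in the base. -/
def coneVec {Y : SSet.{u}} (f : Y ⟶ NZ2.{u}) (a : Z2.{u}) {n : ℕ} :
    ConeSimplex Y n → Fin n → Z2.{u}
  | .apex => 0
  | .join _ h σ => incr (extendZero n h fun j => a + spineSum f σ j)

/-- The parameter `a` belongs to the first base vertex, which may change on passing to a face; `c`
is the sum of `f` between the two. Since `c` does not depend on `a`, it only translates the
parameter. -/
theorem nerveStr_coneVec {Y : SSet.{u}} (f : Y ⟶ NZ2.{u}) {m n : SimplexCategory} (θ : m ⟶ n)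
    (x : ConeSimplex Y n.len) :
    ∃ c : Z2.{u}, ∀ a, nerveStr θ (coneVec f a x) = coneVec f (a + c) (coneStr Y θ x) := by
  cases x with
  | apex =>
    refine ⟨0, fun a => ?_⟩
    funext i
    exact Finset.sum_const_zero
  | join l h σ =>
    by_cases hK : baseCount θ l = 0
    · refine ⟨0, fun a => ?_⟩
      simp only [coneStr, dif_pos hK, coneVec]
      rw [nerveStr_incr]
      simp only [extendZero_comp_of_eq_zero θ h _ hK, incr_zero]
    · refine ⟨spineSum f σ (baseMap θ l h hK 0), fun a => ?_⟩
      simp only [coneStr, dif_neg hK, coneVec]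
      rw [nerveStr_incr, extendZero_comp θ h _ hK]
      congr 2
      funext j
      rw [spineSum_map]
      abel

/-- The `j`-th vertex of a simplex. -/
def vertexOf {Y : SSet.{u}} {n : SimplexCategory} (σ : Y.obj (op n)) (j : Fin (n.len + 1)) :
    Y.obj (op (.mk 0)) :=
  Y.map (SimplexCategory.const (.mk 0) n j).op σ

theorem vertexOf_map {Y : SSet.{u}} {m n : SimplexCategory} (θ : m ⟶ n) (σ : Y.obj (op n))
    (j : Fin (m.len + 1)) : vertexOf (Y.map θ.op σ) j = vertexOf σ (θ j) := by
  rw [vertexOf, vertexOf, ← Functor.map_comp_apply, ← op_comp]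
  rfl

/-- The outcome assignment on the cone with the values `t` on the edges from the apex. -/
def coneAssign {Y : SSet.{u}} (t : Y.obj (op (.mk 0)) → Z2.{u}) : cone Y ⟶ NZ2.{u} where
  app n := ↾fun x : ConeSimplex Y n.unop.len => match x with
    | .apex => (0 : Fin n.unop.len → Z2.{u})
    | .join l h σ => incr (extendZero n.unop.len h fun j => t (vertexOf (n := .mk l) σ j))
  naturality m n g := by
    ext x
    cases x with
    | apex =>
      change (0 : Fin n.unop.len → Z2.{u}) = nerveStr g.unop (0 : Fin m.unop.len → Z2.{u})
      exact funext fun i => Finset.sum_const_zero.symm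
    | join l h σ =>
      change _ = nerveStr g.unop
        (incr (extendZero m.unop.len h fun j => t (vertexOf (n := .mk l) σ j)))
      change (match coneStr Y g.unop (.join l h σ) with
        | .apex => (0 : Fin n.unop.len → Z2.{u})
        | .join l h σ => incr (extendZero n.unop.len h fun j => t (vertexOf (n := .mk l) σ j))) = _
      rw [nerveStr_incr]
      by_cases hK : baseCount g.unop l = 0
      · simp only [coneStr, dif_pos hK, extendZero_comp_of_eq_zero g.unop h _ hK, incr_zero]
      · simp only [coneStr, dif_neg hK]
        rw [extendZero_comp g.unop h _ hK]
        simp only [vertexOf_map]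

/-! ### The distributions `prDist f` -/

/-- The uniform distribution on `ℤ/2`. -/
def uniformZ2 : StdSimplex ℝ Z2.{u} :=
  .duple 0 1 (s := 1 / 2) (t := 1 / 2) (by norm_num) (by norm_num) (by norm_num)

theorem Z2_cases (a : Z2.{u}) : a = 0 ∨ a = 1 := by
  obtain ⟨a⟩ := a
  fin_cases a
  · exact Or.inl rfl
  · exact Or.inr rfl

theorem uniformZ2_weights (a : Z2.{u}) : uniformZ2.weights a = 1 / 2 := by
  have h : (1 : Z2.{u}) ≠ 0 := by simp
  rcases Z2_cases a with rfl | rfl <;> simp [uniformZ2, h, h.symm]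

theorem eq_uniformZ2 (p : StdSimplex ℝ Z2.{u}) (h : p.weights 0 = p.weights 1) : p = uniformZ2 := by
  have huniv : (Finset.univ : Finset Z2.{u}) = {0, 1} := by
    ext a
    simpa using Z2_cases a
  have ht := p.total
  rw [Finsupp.sum_fintype _ _ (by simp), huniv, Finset.sum_pair (by simp), ← h] at ht
  ext a
  rw [uniformZ2_weights]
  rcases Z2_cases a with rfl | rfl
  · linarith
  · rw [← h]; linarith

theorem weights_map_injective {M N : Type*} (p : StdSimplex ℝ M) {g : M → N}
    (hg : Function.Injective g) (a : M) : (p.map g).weights (g a) = p.weights a :=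
  Finsupp.mapDomain_apply hg _ _

theorem uniformZ2_map_add (c : Z2.{u}) : uniformZ2.map (fun a => a + c) = uniformZ2 := by
  ext a
  have := weights_map_injective uniformZ2 (add_left_injective c) (a - c)
  simp only [sub_add_cancel] at this
  rw [this, uniformZ2_weights, uniformZ2_weights]

/-- The distribution on the cone over `Y` which is uniform on the edges from the apex and has the
deterministic value `f` on the base. -/
def prDist {Y : SSet.{u}} (f : Y ⟶ NZ2.{u}) : SDist (cone Y) where
  app n := ↾fun x : ConeSimplex Y n.unop.len =>
    (uniformZ2.map fun a => coneVec f a x : StdSimplex ℝ (Fin n.unop.len → Z2.{u}))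
  naturality m n g := by
    ext x
    change uniformZ2.map (fun a => coneVec f a (coneStr Y g.unop x)) =
      (uniformZ2.map fun a => coneVec f a x).map (nerveStr g.unop)
    obtain ⟨c, hc⟩ := nerveStr_coneVec f g.unop x
    rw [StdSimplex.map_map]
    simp only [hc]
    -- The shift `c` is absorbed by the translation invariance of the uniform distribution.
    conv_lhs => rw [← uniformZ2_map_add c, StdSimplex.map_map]

theorem pullback_prDist {X Y : SSet.{u}} (π : X ⟶ Y) (f : Y ⟶ NZ2.{u}) :
    pullback (coneMap π) (prDist f) = prDist (π ≫ f) := by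
  ext n x
  cases x <;> rfl

/-- The sum of an assignment and the coboundary of a function on the vertices. -/
def addCoboundary {Y : SSet.{u}} (f : Y ⟶ NZ2.{u}) (t : Y.obj (op (.mk 0)) → Z2.{u}) :
    Y ⟶ NZ2.{u} where
  app n := ↾fun σ => f.app n σ +
    (show NZ2.{u}.obj n from incr fun j => t (vertexOf (n := n.unop) σ j))
  naturality m n g := by
    ext σ
    change f.app n (Y.map g σ) +
        (show NZ2.{u}.obj n from incr fun j => t (vertexOf (n := n.unop) (Y.map g σ) j)) =
      NZ2.map g (f.app m σ +
        (show NZ2.{u}.obj m from incr fun j => t (vertexOf (n := m.unop) σ j)))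
    rw [NZ2_map_add, NatTrans.naturality_apply f g σ]
    refine congrArg (_ + ·) (Eq.trans ?_ (nerveStr_incr g.unop _).symm)
    exact congrArg incr (funext fun j => congrArg t (vertexOf_map g.unop σ j))

theorem spineSum_addCoboundary {Y : SSet.{u}} (f : Y ⟶ NZ2.{u})
    (t : Y.obj (op (.mk 0)) → Z2.{u}) {n : SimplexCategory} (σ : Y.obj (op n))
    (j : Fin (n.len + 1)) : spineSum (addCoboundary f t) σ j =
      spineSum f σ j + (t (vertexOf σ j) - t (vertexOf σ 0)) := by
  rw [← partialSum_incr (fun j => t (vertexOf σ j))]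
  exact partialSum_add (A := Z2.{u}) (n := n.len) _ _ j

theorem conv_single {A : Type*} [AddCommGroup A] (b : A) (q : StdSimplex ℝ A) :
    conv (StdSimplex.single b) q = q.map fun c => b + c := by
  rw [conv, iConvexComb, StdSimplex.map_single, ConvexSpace.sConvexComb_single]

theorem mul_det_prDist {Y : SSet.{u}} (f : Y ⟶ NZ2.{u}) (t : Y.obj (op (.mk 0)) → Z2.{u}) :
    mul (det (coneAssign t)) (prDist f) = prDist (addCoboundary f t) := by
  ext n x
  refine (conv_single (A := NZ2.{u}.obj n) _ _).trans ?_
  refine (StdSimplex.map_map _ _ _).trans ?_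
  change (uniformZ2.map fun a => (show Fin n.unop.len → Z2.{u} from (coneAssign t).app n x) +
    coneVec f a (show ConeSimplex Y n.unop.len from x)) =
      uniformZ2.map fun a =>
        coneVec (addCoboundary f t) a (show ConeSimplex Y n.unop.len from x)
  cases x with
  | apex =>
    exact congrArg (uniformZ2.map ·) (funext fun _ => add_zero (0 : Fin n.unop.len → Z2.{u}))
  | join l h σ =>
    -- The spine sums of `addCoboundary f t` are normalised to start at 0, so both sides differ by
    -- the value of `t` at the first base vertex; the uniform parameter absorbs it.
    conv_rhs => rw [← uniformZ2_map_add (t (vertexOf (n := .mk l) σ 0)), StdSimplex.map_map]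
    congr 1
    funext a
    change incr (extendZero n.unop.len h fun j => t (vertexOf (n := .mk l) σ j)) + incr _ = incr _
    rw [← incr_add]
    congr 1
    funext j
    unfold extendZero
    split_ifs
    · simp only [spineSum_addCoboundary]
      abel
    · exact add_zero _

/-! ### Contextuality and extremality of `prDist f` -/

/-- The distribution of a simplicial distribution on the cone at a simplex. -/
def distAt {Y : SSet.{u}} (q : SDist (cone Y)) {n : ℕ} (x : ConeSimplex Y n) :
    StdSimplex ℝ (Fin n → Z2.{u}) :=
  q.app (op (.mk n)) x

theorem distAt_map {Y : SSet.{u}} (q : SDist (cone Y)) {m n : SimplexCategory} (θ : m ⟶ n)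
    (x : ConeSimplex Y n.len) :
    distAt q (coneStr Y θ x) = (distAt q x).map (nerveStr θ) :=
  NatTrans.naturality_apply q (X := op n) (Y := op m) θ.op x

theorem distAt_prDist {Y : SSet.{u}} (f : Y ⟶ NZ2.{u}) {n : ℕ} (x : ConeSimplex Y n) :
    distAt (prDist f) x = uniformZ2.map fun a => coneVec f a x :=
  rfl

theorem map_congr_weights {M N : Type*} (p : StdSimplex ℝ M) {g g' : M → N}
    (h : ∀ b, p.weights b ≠ 0 → g b = g' b) : p.map g = p.map g' := by
  ext1
  exact Finsupp.mapDomain_congr fun b hb => h b (Finsupp.mem_support_iff.1 hb)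

theorem exists_of_weights_map_ne_zero {M N : Type*} (p : StdSimplex ℝ M) (g : M → N) {b : N}
    (h : (p.map g).weights b ≠ 0) : ∃ a, b = g a := by
  by_contra hb
  exact h (Finsupp.mapDomain_of_notMem_range _ _ fun ⟨a, ha⟩ => hb ⟨a, ha.symm⟩)

theorem weights_map_ne_zero {M N : Type*} (p : StdSimplex ℝ M) (g : M → N) {a : M}
    (h : p.weights a ≠ 0) : (p.map g).weights (g a) ≠ 0 := by
  classical
  rw [StdSimplex.weights_map, Finsupp.mapDomain, Finsupp.sum_apply]
  refine (Finset.sum_pos' (fun b _ => ?_) ⟨a, Finsupp.mem_support_iff.2 h, ?_⟩).ne'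
  · beta_reduce
    rw [Finsupp.single_apply]
    split_ifs
    · exact StdSimplex.weights_nonneg b
    · exact le_rfl
  · beta_reduce
    rw [Finsupp.single_eq_same]
    exact lt_of_le_of_ne (StdSimplex.weights_nonneg a) h.symm

/-- The edge of the `n`-simplex from the vertex `0` to the vertex `i`. -/
def edgeFromZero (n : ℕ) (i : Fin (n + 1)) : SimplexCategory.mk 1 ⟶ .mk n :=
  SimplexCategory.mkOfLe 0 i (Fin.zero_le i)

/-- Because `l < n`, vertex 0 of the simplex is at the apex, and vertex `n - l + j` is the `j`-th
vertex of `σ`. -/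
theorem coneStr_edgeFromZero {Y : SSet.{u}} {l n : ℕ} (h : l < n) (σ : Y.obj (op (.mk l)))
    (j : Fin (l + 1)) :
    coneStr Y (edgeFromZero n ⟨n - l + j.val, by omega⟩) (.join l h.le σ) =
      .join 0 (Nat.zero_le _) (vertexOf (n := .mk l) σ j) := by
  have hc : baseCount (edgeFromZero n ⟨n - l + j.val, by omega⟩) l = 1 := by
    have h0 := le_iff_baseCount (edgeFromZero n ⟨n - l + j.val, by omega⟩) l (0 : Fin 2)
    have h1 := le_iff_baseCount (edgeFromZero n ⟨n - l + j.val, by omega⟩) l (1 : Fin 2)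
    change n - l ≤ 0 ↔ 1 + 1 - _ ≤ 0 at h0
    change n - l ≤ n - l + j.val ↔ 1 + 1 - _ ≤ 1 at h1
    omega
  rw [coneStr, dif_neg (by omega)]
  refine join_congr (by omega) σ _ _ fun i h₁ h₂ => ?_
  obtain rfl : i = 0 := by change i < 0 + 1 at h₂; omega
  change (edgeFromZero n ⟨n - l + j.val, by omega⟩ ⟨0 + (1 + 1 - baseCount _ l), _⟩).val - (n - l) =
    j.val
  simp only [hc]
  change n - l + j.val - (n - l) = j.val
  omega

theorem nerveStr_edgeFromZero_coneVec {Y : SSet.{u}} (f : Y ⟶ NZ2.{u}) (a : Z2.{u}) {l n : ℕ}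
    (h : l < n) (σ : Y.obj (op (.mk l))) (j : Fin (l + 1)) :
    nerveStr (edgeFromZero n ⟨n - l + j.val, by omega⟩) (coneVec f a (.join l h.le σ)) 0 =
      a + spineSum f (n := .mk l) σ j := by
  rw [coneVec]
  refine (congrFun (nerveStr_incr (edgeFromZero n ⟨n - l + j.val, by omega⟩) _) 0).trans ?_
  change extendZero n h.le _ ⟨n - l + j.val, by omega⟩ - extendZero n h.le _ 0 = _
  have h0 : ¬ n - l ≤ (0 : Fin (n + 1)).val := by
    change ¬ n - l ≤ 0
    omega
  simp only [extendZero, if_neg h0, if_pos (Nat.le_add_right (n - l) j.val), sub_zero]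
  congr 3
  omega

/-- Without a vertex at the apex, the constant `a` cancels in the increments, so `prDist f` is
deterministic on the base. -/
theorem coneVec_base {Y : SSet.{u}} (f : Y ⟶ NZ2.{u}) (a : Z2.{u}) {n : ℕ}
    (σ : Y.obj (op (.mk n))) : coneVec f a (.join n le_rfl σ) = f.app (op (.mk n)) σ := by
  rw [coneVec, ← incr_spineSum]
  refine Eq.trans ?_ (incr_add_const (spineSum f (n := .mk n) σ) a)
  congr 1
  funext j
  simp [extendZero]

/-- The distribution at the edge from the apex to `v`. -/
def edgeDist {Y : SSet.{u}} (q : SDist (cone Y)) (v : Y.obj (op (.mk 0))) : StdSimplex ℝ Z2.{u} :=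
  (distAt q (.join 0 (Nat.zero_le 1) v)).map fun b => b 0

theorem edgeDist_vertexOf {Y : SSet.{u}} (q : SDist (cone Y)) {l n : ℕ} (h : l < n)
    (σ : Y.obj (op (.mk l))) (j : Fin (l + 1)) :
    edgeDist q (vertexOf (n := .mk l) σ j) =
      (distAt q (.join l h.le σ)).map fun b =>
        nerveStr (edgeFromZero n ⟨n - l + j.val, by omega⟩) b 0 := by
  have := distAt_map q (edgeFromZero n ⟨n - l + j.val, by omega⟩) (.join l h.le σ)
  rw [coneStr_edgeFromZero h] at this
  rw [edgeDist]
  refine (congrArg (fun p => StdSimplex.map (fun b : Fin 1 → Z2.{u} => b 0) p) this).trans ?_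
  exact StdSimplex.map_map _ _ _

/-! ### Distributions supported on the values of `coneVec f` -/

section Support

variable {Y : SSet.{u}} {f : Y ⟶ NZ2.{u}} {q : SDist (cone Y)}

/-- Both apex edges lie in one simplex with a single apex vertex. A vector of its support has the
form `coneVec f a`, with values `a` and `a + spineSum f σ j` on them. -/
theorem edgeDist_eq_map_spineSum
    (hq : ∀ (n : ℕ) (x : ConeSimplex Y n) b, (distAt q x).weights b ≠ 0 → ∃ a, b = coneVec f a x)
    {l : ℕ} (σ : Y.obj (op (.mk l))) (j : Fin (l + 1)) :
    edgeDist q (vertexOf (n := .mk l) σ j) =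
      (edgeDist q (vertexOf (n := .mk l) σ 0)).map fun a => a + spineSum f (n := .mk l) σ j := by
  rw [edgeDist_vertexOf q (Nat.lt_succ_self l) σ j, edgeDist_vertexOf q (Nat.lt_succ_self l) σ 0,
    StdSimplex.map_map]
  refine map_congr_weights _ fun b hb => ?_
  obtain ⟨a, rfl⟩ := hq _ _ _ hb
  rw [nerveStr_edgeFromZero_coneVec f a (Nat.lt_succ_self l) σ j,
    nerveStr_edgeFromZero_coneVec f a (Nat.lt_succ_self l) σ 0]
  congr 1
  exact ((congrArg (a + ·) (spineSum_zero f (n := .mk l) σ)).trans (add_zero a)).symm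

/-- If the simplex has apex and base vertices, a vector of the support is a function of its value on
the edge to the first base vertex, so that marginal determines the distribution. Otherwise the
support is a single point. -/
theorem distAt_eq_of_edgeDist
    (hq : ∀ (n : ℕ) (x : ConeSimplex Y n) b, (distAt q x).weights b ≠ 0 → ∃ a, b = coneVec f a x)
    (hu : ∀ v, edgeDist q v = uniformZ2) {n : ℕ} (x : ConeSimplex Y n) :
    distAt q x = distAt (prDist f) x := by
  rw [distAt_prDist]
  have hconst : ∀ c, (∀ a, coneVec f a x = c) →
      distAt q x = uniformZ2.map fun a => coneVec f a x := by
    intro c hc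
    simp only [hc, StdSimplex.map_const]
    have : (distAt q x).map id = (distAt q x).map fun _ => c := by
      refine map_congr_weights _ fun b hb => ?_
      obtain ⟨a, rfl⟩ := hq _ _ _ hb
      exact hc a
    rwa [StdSimplex.map_id, StdSimplex.map_const] at this
  cases x with
  | apex => exact hconst 0 fun _ => rfl
  | join l h σ =>
    rcases h.lt_or_eq with h' | rfl
    · rw [← hu (vertexOf (n := .mk l) σ 0), edgeDist_vertexOf q h' σ 0, StdSimplex.map_map]
      conv_lhs => rw [← StdSimplex.map_id (distAt q _)]
      refine map_congr_weights _ fun b hb => ?_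
      obtain ⟨a, rfl⟩ := hq _ _ _ hb
      rw [nerveStr_edgeFromZero_coneVec f a h' σ 0]
      exact congrArg (fun c => coneVec f c _)
        ((congrArg (a + ·) (spineSum_zero f (n := .mk l) σ)).trans (add_zero a)).symm
    · exact hconst (f.app (op (.mk l)) σ) fun a => coneVec_base f a σ

end Support

/-! ### Non-coboundaries give contextual vertices -/

/-- An assignment that is, on edges, the coboundary of a function on the vertices. -/
def IsCoboundary {Y : SSet.{u}} (f : Y ⟶ NZ2.{u}) : Prop :=
  ∃ t : Y.obj (op (.mk 0)) → Z2.{u}, ∀ e : Y.obj (op (.mk 1)),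
    spineSum f (n := .mk 1) e 1 = t (vertexOf (n := .mk 1) e 1) - t (vertexOf (n := .mk 1) e 0)

/-- Properties of vertices which are invariant along edges hold for all vertices or for none. -/
def VertexConnected (Y : SSet.{u}) : Prop :=
  ∀ P : Y.obj (op (.mk 0)) → Prop,
    (∀ e : Y.obj (op (.mk 1)), P (vertexOf (n := .mk 1) e 0) ↔ P (vertexOf (n := .mk 1) e 1)) →
      ∀ v w, P v → P w

theorem edgeDist_eq_uniformZ2 {Y : SSet.{u}} {f : Y ⟶ NZ2.{u}} {q : SDist (cone Y)}
    (hY : VertexConnected Y) (hf : ¬ IsCoboundary f)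
    (hq : ∀ (n : ℕ) (x : ConeSimplex Y n) b, (distAt q x).weights b ≠ 0 → ∃ a, b = coneVec f a x)
    (v : Y.obj (op (.mk 0))) : edgeDist q v = uniformZ2 := by
  -- The bias of the apex edge at `v`: an edge with label 0 preserves it, an edge with label 1
  -- changes its sign.
  let D : Y.obj (op (.mk 0)) → ℝ := fun v =>
    (edgeDist q v).weights 0 - (edgeDist q v).weights 1
  have hD : ∀ e : Y.obj (op (.mk 1)),
      (spineSum f (n := .mk 1) e 1 = 0 ∧
        D (vertexOf (n := .mk 1) e 1) = D (vertexOf (n := .mk 1) e 0)) ∨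
      (spineSum f (n := .mk 1) e 1 = 1 ∧
        D (vertexOf (n := .mk 1) e 1) = - D (vertexOf (n := .mk 1) e 0)) := by
    intro e
    have h := edgeDist_eq_map_spineSum hq e 1
    have hw := fun a => weights_map_injective (edgeDist q (vertexOf (n := .mk 1) e 0))
      (add_left_injective (spineSum f (n := .mk 1) e 1)) a
    have h0 := hw 0
    have h1 := hw 1
    rw [← h] at h0 h1
    have h2 : (1 : Z2.{u}) + 1 = 0 := rfl
    rcases Z2_cases (spineSum f (n := .mk 1) e 1) with hs | hs
    · refine Or.inl ⟨hs, ?_⟩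
      simp only [hs, add_zero] at h0 h1
      simp only [D, h0, h1]
    · refine Or.inr ⟨hs, ?_⟩
      simp only [hs, zero_add, h2] at h0 h1
      simp only [D, h0, h1]
      ring
  by_cases hv : D v = 0
  · exact eq_uniformZ2 _ (sub_eq_zero.1 hv)
  · exfalso
    have hne : ∀ w, D w ≠ 0 := by
      intro w
      refine hY (fun v => D v ≠ 0) (fun e => ?_) v w hv
      rcases hD e with ⟨-, h⟩ | ⟨-, h⟩ <;> simp [h]
    -- A bias that vanishes nowhere has a sign, and `f` records exactly its changes along edges.
    refine hf ⟨fun w => if 0 < D w then 0 else 1, fun e => ?_⟩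
    have h3 := hne (vertexOf (n := .mk 1) e 0)
    rcases hD e with ⟨hs, h⟩ | ⟨hs, h⟩
    · beta_reduce
      rw [hs, h, sub_self]
    · beta_reduce
      rw [hs, h]
      rcases lt_or_gt_of_ne h3 with h4 | h4
      · rw [if_pos (by linarith), if_neg (by linarith)]
        rfl
      · rw [if_neg (by linarith), if_pos h4]
        rfl

theorem isVertex_prDist {Y : SSet.{u}} {f : Y ⟶ NZ2.{u}} (hY : VertexConnected Y)
    (hf : ¬ IsCoboundary f) : IsVertex (prDist f) := by
  refine mem_extremePoints.2 ⟨⟨_, rfl⟩, ?_⟩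
  -- Extremality reduces to uniqueness among distributions with no larger support, since both terms
  -- of a convex decomposition have this property.
  have key : ∀ q : SDist (cone Y), (∀ (n : ℕ) (x : ConeSimplex Y n) b,
      (distAt (prDist f) x).weights b = 0 → (distAt q x).weights b = 0) →
        coords q = coords (prDist f) := by
    intro q h
    have hq : ∀ (n : ℕ) (x : ConeSimplex Y n) b, (distAt q x).weights b ≠ 0 →
        ∃ a, b = coneVec f a x := fun n x b hb =>
      exists_of_weights_map_ne_zero uniformZ2 _ fun h' => hb (h n x b h')
    funext n x b
    have := distAt_eq_of_edgeDist hq (edgeDist_eq_uniformZ2 hY hf hq) (n := n) x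
    exact congrArg (fun p => p.weights b) this
  rintro _ ⟨q₁, rfl⟩ _ ⟨q₂, rfl⟩ ⟨s, t, hs, ht, -, hst⟩
  have hst' : ∀ (n : ℕ) (x : ConeSimplex Y n) b,
      s * (distAt q₁ x).weights b + t * (distAt q₂ x).weights b =
        (distAt (prDist f) x).weights b := fun n x b =>
    congrFun (congrFun (congrFun hst n) x) b
  constructor
  · refine key q₁ fun n x b hb => ?_
    have h := hst' n x b
    have h₁ : 0 ≤ (distAt q₁ x).weights b := StdSimplex.weights_nonneg b
    have h₂ : 0 ≤ (distAt q₂ x).weights b := StdSimplex.weights_nonneg b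
    rw [hb] at h
    have := mul_nonneg ht.le h₂
    nlinarith
  · refine key q₂ fun n x b hb => ?_
    have h := hst' n x b
    have h₁ : 0 ≤ (distAt q₁ x).weights b := StdSimplex.weights_nonneg b
    have h₂ : 0 ≤ (distAt q₂ x).weights b := StdSimplex.weights_nonneg b
    rw [hb] at h
    have := mul_nonneg hs.le h₁
    nlinarith

theorem isContextual_prDist {Y : SSet.{u}} {f : Y ⟶ NZ2.{u}} (hf : ¬ IsCoboundary f) :
    IsContextual (prDist f) := by
  rintro ⟨d, hd⟩
  obtain ⟨s, hs⟩ := d.support_weights_nonempty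
  rw [Finsupp.mem_support_iff] at hs
  have hsupp : ∀ {n : ℕ} (x : ConeSimplex Y n),
      ∃ a, (show Fin n → Z2.{u} from s.app (op (.mk n)) x) = coneVec f a x := by
    intro n x
    refine exists_of_weights_map_ne_zero uniformZ2 _ ?_
    rw [← distAt_prDist, ← hd]
    exact weights_map_ne_zero d (fun s => (show Fin n → Z2.{u} from s.app (op (.mk n)) x)) hs
  -- The function is the value of `s` on the edge from the apex to `v`. The 2-simplex over `e` has a
  -- value `coneVec f a`, so the two apex edges differ by the label of `e`.
  refine hf ⟨fun v => (show Fin 1 → Z2.{u} from s.app (op (.mk 1)) (.join 0 (Nat.zero_le 1) v)) 0,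
    fun e => ?_⟩
  have hv : ∀ j : Fin 2, (show Fin 1 → Z2.{u} from s.app (op (.mk 1))
      (.join 0 (Nat.zero_le 1) (vertexOf (n := .mk 1) e j))) 0 =
        nerveStr (edgeFromZero 2 ⟨2 - 1 + j.val, by omega⟩)
          (show Fin 2 → Z2.{u} from s.app (op (.mk 2)) (.join 1 one_le_two e)) 0 := by
    intro j
    have h := coneStr_edgeFromZero (n := 2) (l := 1) (by omega) e j
    refine (congrArg (fun x => (show Fin 1 → Z2.{u} from s.app (op (.mk 1)) x) 0) h.symm).trans ?_
    exact congrFun (NatTrans.naturality_apply s (X := op (.mk 2)) (Y := op (.mk 1))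
      (edgeFromZero 2 ⟨2 - 1 + j.val, by omega⟩).op (.join 1 one_le_two e)) 0
  obtain ⟨a, ha⟩ := hsupp (n := 2) (.join 1 one_le_two e)
  have hv' := fun j : Fin 2 => (hv j).trans ((congrArg (fun b : Fin 2 → Z2.{u} =>
    nerveStr (edgeFromZero 2 ⟨2 - 1 + j.val, by omega⟩) b 0) ha).trans
      (nerveStr_edgeFromZero_coneVec f a one_lt_two e j))
  refine Eq.trans ?_ (congrArg₂ (· - ·) (hv' 1) (hv' 0)).symm
  refine Eq.symm ((congrArg (fun c => _ - (a + c)) (spineSum_zero f (n := .mk 1) e)).trans ?_)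
  abel

theorem prDist_mem_contextualVertices {Y : SSet.{u}} {f : Y ⟶ NZ2.{u}} (hY : VertexConnected Y)
    (hf : ¬ IsCoboundary f) : prDist f ∈ contextualVertices (cone Y) :=
  ⟨isVertex_prDist hY hf, isContextual_prDist hf⟩

theorem prDist_injective {Y : SSet.{u}} {f g : Y ⟶ NZ2.{u}} (h : prDist f = prDist g) :
    f = g := by
  ext ⟨n⟩ σ
  have h' : distAt (prDist f) (.join n.len le_rfl σ) = distAt (prDist g) (.join n.len le_rfl σ) := by
    rw [h]
  simp only [distAt_prDist, coneVec_base] at h'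
  have := (StdSimplex.map_const _ _).symm.trans (h'.trans (StdSimplex.map_const _ _))
  exact (Finsupp.single_left_inj one_ne_zero).1 (congrArg StdSimplex.weights this)

/-! ### Assignments on a graph given by labels of the edges -/

theorem vertexOf_one_zero {X : SSet.{u}} (e : X.obj (op (.mk 1))) :
    vertexOf (n := .mk 1) e 0 = X.δ 1 e := by
  have h : SimplexCategory.const (.mk 0) (.mk 1) 0 = SimplexCategory.δ 1 := by
    ext i
    fin_cases i
    rfl
  rw [vertexOf, h]
  rfl

theorem vertexOf_one_one {X : SSet.{u}} (e : X.obj (op (.mk 1))) :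
    vertexOf (n := .mk 1) e 1 = X.δ 0 e := by
  have h : SimplexCategory.const (.mk 0) (.mk 1) 1 = SimplexCategory.δ 0 := by
    ext i
    fin_cases i
    rfl
  rw [vertexOf, h]
  rfl

theorem map_const_mem_degenerate {X : SSet.{u}} {n : ℕ} (σ : X.obj (op (.mk n)))
    (θ : SimplexCategory.mk 1 ⟶ .mk n) (hθ : θ 0 = θ 1) : X.map θ.op σ ∈ X.degenerate 1 := by
  refine ⟨0, one_pos, SimplexCategory.σ 0,
    X.map (SimplexCategory.const (.mk 0) (.mk n) (θ 0)).op σ, ?_⟩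
  rw [← Functor.map_comp_apply, ← op_comp]
  have h : SimplexCategory.σ (n := 0) 0 ≫ SimplexCategory.const (.mk 0) (.mk n) (θ 0) = θ := by
    ext i
    fin_cases i
    · rfl
    · exact congrArg Fin.val hθ
  rw [h]

section Cochain

variable {X : SSet.{u}} {b : X.obj (op (.mk 1)) → Z2.{u}}

/-- A map `[1] → [1]` is constant or the identity. The right side is the increment along `θ` of the
function with values `0` and `b y` on the two vertices. -/
theorem cochain_edge (hb : ∀ e ∈ X.degenerate 1, b e = 0) (y : X.obj (op (.mk 1)))
    (θ : SimplexCategory.mk 1 ⟶ .mk 1) :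
    b (X.map θ.op y) = (if θ 1 = 0 then 0 else b y) - if θ 0 = 0 then 0 else b y := by
  by_cases h : θ 0 = θ 1
  · rw [hb _ (map_const_mem_degenerate y θ h), h, sub_self]
  · have hle : θ 0 ≤ θ 1 := θ.toOrderHom.monotone (by decide)
    have h0 : θ 0 = (0 : Fin 2) := by
      generalize θ 0 = p, θ 1 = q at *
      change Fin 2 at p q
      revert p q
      decide
    have h1 : θ 1 = (1 : Fin 2) := by
      generalize θ 0 = p, θ 1 = q at *
      change Fin 2 at p q
      revert p q
      decide
    have hθ : θ = 𝟙 _ := by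
      ext i
      fin_cases i
      · exact congrArg Fin.val h0
      · exact congrArg Fin.val h1
    rw [if_neg (by rw [h1]; decide), if_pos h0, sub_zero, hθ]
    simp

/-- In dimension at most 1 the triangle on the vertices `0, i, j` is degenerate on some edge `y`.
Its three labels are increments of one function on the vertices of `y`, so they satisfy the cocycle
relation. -/
theorem cochain_triangle [X.HasDimensionLE 1] (hb : ∀ e ∈ X.degenerate 1, b e = 0) {n : ℕ}
    (σ : X.obj (op (.mk n))) {i j : Fin (n + 1)} (hij : i ≤ j) :
    b (X.map (SimplexCategory.mkOfLe i j hij).op σ) =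
      b (X.map (edgeFromZero n j).op σ) - b (X.map (edgeFromZero n i).op σ) := by
  let τ := X.map (SimplexCategory.mkOfLeComp 0 i j (Fin.zero_le i) hij).op σ
  have hτ : τ ∈ X.degenerate 2 := by
    rw [X.degenerate_eq_univ_of_hasDimensionLT 2 2]
    trivial
  rw [SSet.degenerate_eq_iUnion_range_σ] at hτ
  obtain ⟨k, y, hy⟩ := Set.mem_iUnion.1 hτ
  have key : ∀ (p q : Fin 3) (hpq : p ≤ q) (θ : SimplexCategory.mk 1 ⟶ .mk n),
      SimplexCategory.mkOfLe p q hpq ≫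
        SimplexCategory.mkOfLeComp 0 i j (Fin.zero_le i) hij = θ →
      b (X.map θ.op σ) =
        (if SimplexCategory.σ k q = 0 then 0 else b y) -
          if SimplexCategory.σ k p = 0 then 0 else b y := by
    rintro p q hpq θ rfl
    have h1 : X.map (SimplexCategory.mkOfLe p q hpq ≫
        SimplexCategory.mkOfLeComp 0 i j (Fin.zero_le i) hij).op σ =
          X.map (SimplexCategory.mkOfLe p q hpq ≫ SimplexCategory.σ k).op y := by
      rw [op_comp, op_comp, Functor.map_comp_apply, Functor.map_comp_apply]
      exact congrArg _ hy.symm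
    rw [h1, cochain_edge hb]
    rfl
  rw [key 1 2 (by decide) _ (by ext i; fin_cases i <;> rfl),
    key 0 2 (by decide) (edgeFromZero n j) (by ext i; fin_cases i <;> rfl),
    key 0 1 (by decide) (edgeFromZero n i) (by ext i; fin_cases i <;> rfl)]
  abel

/-- The assignment on a graph with given labels of the edges. -/
def ofCochain [X.HasDimensionLE 1] (b : X.obj (op (.mk 1)) → Z2.{u})
    (hb : ∀ e ∈ X.degenerate 1, b e = 0) : X ⟶ NZ2.{u} where
  app n := ↾fun σ => incr fun j => b (X.map (edgeFromZero n.unop.len j).op σ)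
  naturality m n g := by
    ext σ
    refine Eq.trans ?_ (nerveStr_incr (A := Z2.{u}) g.unop fun j =>
      b (X.map (edgeFromZero m.unop.len j).op σ)).symm
    -- Passing to `X.map g σ` moves the base point from vertex `0` to vertex `g 0`, which changes
    -- the potential only by a constant.
    refine Eq.trans ?_ (incr_add_const (A := Z2.{u}) _
      (-b (X.map (edgeFromZero m.unop.len (g.unop 0)).op σ)))
    change incr (A := Z2.{u}) (fun j => b (X.map (edgeFromZero n.unop.len j).op (X.map g σ))) = _
    refine congrArg (incr (A := Z2.{u})) (funext fun j => ?_)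
    have hle : g.unop 0 ≤ g.unop j := g.unop.toOrderHom.monotone (Fin.zero_le j)
    have h := cochain_triangle (n := m.unop.len) hb σ hle
    rw [sub_eq_neg_add] at h
    refine Eq.trans ?_ h
    change b (X.map _ (X.map g.unop.op σ)) = _
    have hθ : edgeFromZero n.unop.len j ≫ g.unop = SimplexCategory.mkOfLe _ _ hle := by
      ext i
      fin_cases i <;> rfl
    rw [← Functor.map_comp_apply, ← op_comp]
    exact congrArg (fun θ : SimplexCategory.mk 1 ⟶ m.unop => b (X.map θ.op σ)) hθ

theorem spineSum_ofCochain [X.HasDimensionLE 1] (hb : ∀ e ∈ X.degenerate 1, b e = 0)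
    (e : X.obj (op (.mk 1))) : spineSum (ofCochain b hb) (n := .mk 1) e 1 = b e := by
  refine (partialSum_incr (A := Z2.{u}) (n := 1)
    (fun j => b (X.map (edgeFromZero 1 j).op e)) 1).trans ?_
  have h1 : edgeFromZero 1 1 = 𝟙 _ := by
    ext i
    fin_cases i <;> rfl
  have h0 : b (X.map (edgeFromZero 1 0).op e) = 0 :=
    hb _ (map_const_mem_degenerate e (edgeFromZero 1 0) rfl)
  change b (X.map (edgeFromZero 1 1).op e) - b (X.map (edgeFromZero 1 0).op e) = b e
  rw [h0, h1]
  simp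

end Cochain

theorem not_isCoboundary_addCoboundary {X : SSet.{u}} {f : X ⟶ NZ2.{u}} (hf : ¬ IsCoboundary f)
    (t : X.obj (op (.mk 0)) → Z2.{u}) : ¬ IsCoboundary (addCoboundary f t) := by
  rintro ⟨t', h⟩
  refine hf ⟨fun v => t' v - t v, fun e => ?_⟩
  have := h e
  rw [spineSum_addCoboundary] at this
  rw [eq_sub_of_add_eq this]
  beta_reduce
  abel

theorem vertexConnected_of_isConnected (X : SSet.{u}) [X.IsConnected] : VertexConnected X := by
  intro P hP v w
  suffices h : P v ↔ P w from h.1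
  have h := (SSet.π₀.mk_eq_mk_iff v w).1 (Subsingleton.elim _ _)
  induction h with
  | rel x y h =>
    obtain ⟨e⟩ := h
    have := hP e.edge
    rw [vertexOf_one_zero, vertexOf_one_one] at this
    rwa [e.src_eq, e.tgt_eq] at this
  | refl x => exact Iff.rfl
  | symm x y _ ih => exact ih.symm
  | trans x y z _ _ ih₁ ih₂ => exact ih₁.trans ih₂

/-! ### Assignments that factor through the collapsing map -/

section Collapse

variable {X : SSet.{u}} {T : X.Subcomplex}

/-- The map on the quotient `X/T` induced by a map on `X`. -/
def collapseLift {Z : SSet.{u}} (f : X ⟶ Z)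
    (h : ∀ n, ∀ a ∈ T.obj n, ∀ b ∈ T.obj n, f.app n a = f.app n b) : collapse T ⟶ Z where
  app n := ↾(Quot.lift (f.app n) fun a b hab => h n a hab.1 b hab.2)
  naturality m n g := by
    ext x
    induction x using Quot.ind with
    | mk a => exact NatTrans.naturality_apply f g a

theorem vertexOf_app {X Y : SSet.{u}} (π : X ⟶ Y) {n : SimplexCategory} (σ : X.obj (op n))
    (j : Fin (n.len + 1)) : vertexOf (π.app _ σ) j = π.app _ (vertexOf σ j) :=
  (NatTrans.naturality_apply π _ σ).symm

theorem vertexConnected_collapse (hX : VertexConnected X) : VertexConnected (collapse T) := by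
  intro P hP v w
  obtain ⟨v, rfl⟩ := Quot.exists_rep v
  obtain ⟨w, rfl⟩ := Quot.exists_rep w
  exact hX (fun v => P (Quot.mk _ v)) (fun e => hP (Quot.mk _ e)) v w

theorem not_isCoboundary_of_comp {X Y : SSet.{u}} (π : X ⟶ Y) {f : Y ⟶ NZ2.{u}}
    (hf : ¬ IsCoboundary (π ≫ f)) : ¬ IsCoboundary f := by
  rintro ⟨t, ht⟩
  refine hf ⟨fun v => t (π.app _ v), fun e => ?_⟩
  simp only [← vertexOf_app]
  exact ht (π.app _ e)

/-- All edges of a simplex of `T` lie in `T`. This is what lets the assignment descend to `X/T`. -/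
theorem ofCochain_eq_zero [X.HasDimensionLE 1] {b : X.obj (op (.mk 1)) → Z2.{u}}
    (hb : ∀ e ∈ X.degenerate 1, b e = 0) (hT : ∀ e ∈ T.obj (op (.mk 1)), b e = 0)
    (n : SimplexCategoryᵒᵖ) (σ : X.obj n) (hσ : σ ∈ T.obj n) :
    (ofCochain b hb).app n σ = (0 : NZ2.{u}.obj n) := by
  have h : (fun j => b (X.map (edgeFromZero n.unop.len j).op σ)) = fun _ => 0 :=
    funext fun j => hT _ (T.map (edgeFromZero n.unop.len j).op hσ)
  exact (congrArg (incr (A := Z2.{u})) h).trans incr_zero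

end Collapse

/-! ### Labels of the edges given by a homomorphism on the fundamental group -/

section Holonomy

variable {X : SSet.{u}} {x : X.obj (op (.mk 0))}

/-- The class of a non-degenerate edge in the fundamental groupoid. -/
def edgeClass (e : X.obj (op (.mk 1))) (he : e ∈ X.nonDegenerate 1) :
    vert (X.δ 1 e) ⟶ vert (X.δ 0 e) :=
  (Quiver.FreeGroupoid.of (Graph X)).map
    (⟨e, he, rfl, rfl⟩ : @Quiver.Hom (Graph X) _ (X.δ 1 e) (X.δ 0 e))

/-- The vertex underlying an object of the fundamental groupoid. -/
def vertexAt (a : FundGroupoid X) : X.obj (op (.mk 0)) := a.as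

/-- The loop at `x` made of a morphism of the fundamental groupoid and the chosen paths from `x`
to its ends. -/
def loopOf (γ : ∀ a : FundGroupoid X, vert x ⟶ a) {a b : FundGroupoid X} (g : a ⟶ b) :
    FundGroup X x :=
  γ a ≫ g ≫ Groupoid.inv (γ b)

theorem loopOf_comp (γ : ∀ a : FundGroupoid X, vert x ⟶ a) {a b c : FundGroupoid X}
    (g : a ⟶ b) (h : b ⟶ c) : loopOf γ (g ≫ h) = loopOf γ h * loopOf γ g := by
  rw [End.mul_def]
  simp [loopOf]

theorem loopOf_id (γ : ∀ a : FundGroupoid X, vert x ⟶ a) (a : FundGroupoid X) :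
    loopOf γ (𝟙 a) = 1 := by
  rw [End.one_def]
  simp [loopOf]

/-- The functor given by a homomorphism on the fundamental group and a function on the vertices. -/
def holonomy (γ : ∀ a : FundGroupoid X, vert x ⟶ a)
    (φ : FundGroup X x →* Multiplicative Z2.{u}) (t : X.obj (op (.mk 0)) → Z2.{u}) :
    FundGroupoid X ⥤ SingleObj (Multiplicative Z2.{u}) where
  obj _ := SingleObj.star _
  map {a b} g := (φ (loopOf γ g) *
    Multiplicative.ofAdd (t (vertexAt b) - t (vertexAt a)) : Multiplicative Z2.{u})
  map_id a := by
    change φ (loopOf γ (𝟙 a)) * Multiplicative.ofAdd (t (vertexAt a) - t (vertexAt a)) = 1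
    rw [loopOf_id, sub_self, map_one]
    rfl
  map_comp {a b c} g h := by
    change φ (loopOf γ (g ≫ h)) * Multiplicative.ofAdd (t (vertexAt c) - t (vertexAt a)) =
      (φ (loopOf γ h) * Multiplicative.ofAdd (t (vertexAt c) - t (vertexAt b))) *
        (φ (loopOf γ g) * Multiplicative.ofAdd (t (vertexAt b) - t (vertexAt a)))
    rw [loopOf_comp, map_mul, mul_mul_mul_comm, ← ofAdd_add, sub_add_sub_cancel]

open Classical in
/-- The labels of the edges given by a homomorphism on the fundamental group. -/
def label (γ : ∀ a : FundGroupoid X, vert x ⟶ a)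
    (φ : FundGroup X x →* Multiplicative Z2.{u}) (e : X.obj (op (.mk 1))) : Z2.{u} :=
  if he : e ∈ X.nonDegenerate 1 then (φ (loopOf γ (edgeClass e he))).toAdd else 0

theorem label_of_degenerate (γ : ∀ a : FundGroupoid X, vert x ⟶ a)
    (φ : FundGroup X x →* Multiplicative Z2.{u}) (e : X.obj (op (.mk 1)))
    (he : e ∈ X.degenerate 1) : label γ φ e = 0 :=
  dif_neg fun h => h he

/-- Functors on a free groupoid are determined by their values on the generating edges. -/
theorem holonomy_eq {γ : ∀ a : FundGroupoid X, vert x ⟶ a}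
    {φ φ' : FundGroup X x →* Multiplicative Z2.{u}} {t t' : X.obj (op (.mk 0)) → Z2.{u}}
    (h : ∀ e, label γ φ e + (t (X.δ 0 e) - t (X.δ 1 e)) =
      label γ φ' e + (t' (X.δ 0 e) - t' (X.δ 1 e))) :
    holonomy γ φ t = holonomy γ φ' t' := by
  have key : ∀ (v w : X.obj (op (.mk 0))) (e : @Quiver.Hom (Graph X) _ v w),
      (holonomy γ φ t).map ((Quiver.FreeGroupoid.of (Graph X)).map e) =
        (holonomy γ φ' t').map ((Quiver.FreeGroupoid.of (Graph X)).map e) := by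
    rintro _ _ ⟨e, he, rfl, rfl⟩
    have := h e
    rw [label, label, dif_pos he, dif_pos he] at this
    exact congrArg Multiplicative.ofAdd this
  exact IsFreeGroupoid.ext_functor _ _ fun a b e => key _ _ e

/-- The labels determine the holonomy functor. On loops at `x` the term from `t` cancels and the
functor is `φ`; on the chosen path to `v` the loop is trivial and only `t v - t x` remains. -/
theorem eq_and_eq_of_label_eq {γ : ∀ a : FundGroupoid X, vert x ⟶ a} (hγ : γ (vert x) = 𝟙 _)
    {φ φ' : FundGroup X x →* Multiplicative Z2.{u}} {t t' : X.obj (op (.mk 0)) → Z2.{u}}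
    (h : ∀ e, label γ φ e + (t (X.δ 0 e) - t (X.δ 1 e)) =
      label γ φ' e + (t' (X.δ 0 e) - t' (X.δ 1 e))) :
    φ = φ' ∧ ∀ v, t v - t x = t' v - t' x := by
  have hF := holonomy_eq h
  have key : ∀ {v w : X.obj (op (.mk 0))} (g : vert v ⟶ vert w),
      φ (loopOf γ g) * Multiplicative.ofAdd (t w - t v) =
        φ' (loopOf γ g) * Multiplicative.ofAdd (t' w - t' v) := by
    intro v w g
    exact eq_of_heq (congr_arg_heq
      (fun F : FundGroupoid X ⥤ SingleObj (Multiplicative Z2.{u}) => F.map g) hF)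
  constructor
  · ext g
    have h1 : loopOf γ (a := vert x) (b := vert x) g = g := by
      simp [loopOf, hγ]
    have := key (v := x) (w := x) g
    rw [h1, sub_self, sub_self, ofAdd_zero, mul_one, mul_one] at this
    rw [this]
  · intro v
    have h1 : loopOf γ (γ (vert v)) = 1 := by
      rw [End.one_def]
      simp [loopOf, hγ]
    have := key (γ (vert v))
    rw [h1, map_one, map_one, one_mul, one_mul] at this
    exact Multiplicative.ofAdd.injective this

/-- The assignment on a graph given by a homomorphism on the fundamental group. -/
def assignOfHom [X.HasDimensionLE 1] (γ : ∀ a : FundGroupoid X, vert x ⟶ a)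
    (φ : FundGroup X x →* Multiplicative Z2.{u}) : X ⟶ NZ2.{u} :=
  ofCochain (label γ φ) (label_of_degenerate γ φ)

theorem spineSum_assignOfHom [X.HasDimensionLE 1]
    (γ : ∀ a : FundGroupoid X, vert x ⟶ a)
    (φ : FundGroup X x →* Multiplicative Z2.{u}) (e : X.obj (op (.mk 1))) :
    spineSum (assignOfHom γ φ) (n := .mk 1) e 1 = label γ φ e :=
  spineSum_ofCochain _ e

theorem not_isCoboundary_assignOfHom [X.HasDimensionLE 1]
    {γ : ∀ a : FundGroupoid X, vert x ⟶ a} (hγ : γ (vert x) = 𝟙 _)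
    {φ : FundGroup X x →* Multiplicative Z2.{u}} (hφ : φ ≠ 1) :
    ¬ IsCoboundary (assignOfHom γ φ) := by
  rintro ⟨t, ht⟩
  -- If the labels of `φ` are `dt`, then the pairs `(φ, 0)` and `(1, t)` label all edges alike, so
  -- `φ = 1`.
  refine hφ (eq_and_eq_of_label_eq hγ (t := fun _ => 0) (t' := t) fun e => ?_).1
  have h1 : label γ (1 : FundGroup X x →* Multiplicative Z2.{u}) e = 0 := by
    unfold label
    split_ifs <;> rfl
  rw [h1, ← spineSum_assignOfHom, ht, vertexOf_one_zero, vertexOf_one_one]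
  abel

theorem prDist_assignOfHom_injective [X.HasDimensionLE 1]
    {γ : ∀ a : FundGroupoid X, vert x ⟶ a} (hγ : γ (vert x) = 𝟙 _)
    {φ φ' : FundGroup X x →* Multiplicative Z2.{u}} {t t' : X.obj (op (.mk 0)) → Z2.{u}}
    (h : prDist (addCoboundary (assignOfHom γ φ) t) =
      prDist (addCoboundary (assignOfHom γ φ') t')) :
    φ = φ' ∧ ∀ v, t v - t x = t' v - t' x := by
  refine eq_and_eq_of_label_eq hγ fun e => ?_
  have := congrArg (fun f => spineSum f (n := .mk 1) e 1) (prDist_injective h)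
  simp only [spineSum_addCoboundary] at this
  rwa [spineSum_assignOfHom, spineSum_assignOfHom, vertexOf_one_zero, vertexOf_one_one] at this

/-! ### Counting the distributions -/

open Classical in
theorem le_encard_of_prDist_mem [X.HasDimensionLE 1] [X.IsConnected]
    {γ : ∀ a : FundGroupoid X, vert x ⟶ a} (hγ : γ (vert x) = 𝟙 _) {S : Set (SDist (cone X))}
    (hS : ∀ φ : FundGroup X x →* Multiplicative Z2.{u}, φ ≠ 1 →
      ∀ t, prDist (addCoboundary (assignOfHom γ φ) t) ∈ S) :
    ((2 : ℕ∞) ^ numGenerators X x - 1) * 2 ^ (ENat.card (X.obj (op (.mk 0))) - 1) ≤ S.encard := by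
  have h2 : ENat.card Z2.{u} = 2 := by
    rw [ENat.card_congr Equiv.ulift]
    simp
  have hA : ENat.card {φ : FundGroup X x →* Multiplicative Z2.{u} // φ ≠ 1} =
      2 ^ numGenerators X x - 1 := by
    have h := Set.encard_sdiff_singleton_of_mem
      (Set.mem_univ (1 : FundGroup X x →* Multiplicative Z2.{u}))
    -- Homomorphisms from a free group are arbitrary functions on its generators.
    rw [Set.encard_univ,
      ← ENat.card_congr (IsFreeGroup.lift (G := FundGroup X x) (H := Multiplicative Z2.{u})),
      ENat.card_fun, ENat.card_congr Multiplicative.toAdd, h2] at h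
    rw [numGenerators, ← h, ← ENat.card_coe_set_eq]
    exact ENat.card_congr (Equiv.subtypeEquivRight fun φ => by simp)
  have hB : ENat.card ({v : X.obj (op (.mk 0)) // v ≠ x} → Z2.{u}) =
      2 ^ (ENat.card (X.obj (op (.mk 0))) - 1) := by
    have h := Set.encard_sdiff_singleton_of_mem (Set.mem_univ x)
    rw [Set.encard_univ, ← ENat.card_coe_set_eq] at h
    rw [ENat.card_fun, h2, ← h]
    congr 1
    exact ENat.card_congr (Equiv.subtypeEquivRight fun φ => by simp)
  rw [← hA, ← hB, ← ENat.card_prod, ← ENat.card_coe_set_eq]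
  -- A function `t` matters only up to a constant, so it is normalised to vanish at `x`; this
  -- accounts for the `- 1` in the exponent.
  let ext0 : ({v : X.obj (op (.mk 0)) // v ≠ x} → Z2.{u}) → X.obj (op (.mk 0)) → Z2.{u} :=
    fun t v => if h : v ≠ x then t ⟨v, h⟩ else 0
  refine ENat.card_le_card_of_injective (f := fun p => ⟨_, hS p.1.1 p.1.2 (ext0 p.2)⟩) ?_
  rintro ⟨φ, t⟩ ⟨φ', t'⟩ h
  obtain ⟨h₁, h₂⟩ := prDist_assignOfHom_injective hγ (congrArg Subtype.val h)
  refine Prod.ext (Subtype.ext h₁) (funext fun v => ?_)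
  simpa [ext0, v.2] using h₂ v.1

end Holonomy

/-! ### Paths in a maximal tree -/

theorem exists_paths (X : SSet.{u}) [X.IsConnected] (x : X.obj (op (.mk 0))) :
    ∃ γ : ∀ a : FundGroupoid X, vert x ⟶ a, γ (vert x) = 𝟙 _ := by
  have h : ∀ a : FundGroupoid X, Nonempty (vert x ⟶ a) := fun a => inferInstance
  let γ := fun a => (h a).some
  -- Arbitrary paths are corrected by the inverse of the one chosen at `x`, so that the path at `x`
  -- is trivial.
  exact ⟨fun a => Groupoid.inv (γ (vert x)) ≫ γ a, by simp⟩

section Tree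

variable {X : SSet.{u}} (T : X.Subcomplex)

/-- The inclusion of a simplicial subset on graphs. -/
def graphInclusion : Graph (T : SSet.{u}) ⥤q Graph X where
  obj v := Subtype.val v
  map e := ⟨e.1.1, (SSet.nonDegenerate_iff_of_mono T.ι e.1).2 e.2.1,
    congrArg Subtype.val e.2.2.1, congrArg Subtype.val e.2.2.2⟩

/-- The inclusion of a simplicial subset on fundamental groupoids. -/
def groupoidInclusion : FundGroupoid (T : SSet.{u}) ⥤ FundGroupoid X :=
  Quiver.freeGroupoidFunctor (graphInclusion T)

theorem groupoidInclusion_edgeClass (e : (T : SSet.{u}).obj (op (.mk 1)))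
    (he : e ∈ (T : SSet.{u}).nonDegenerate 1) (he' : e.1 ∈ X.nonDegenerate 1) :
    (groupoidInclusion T).map (edgeClass e he) = edgeClass (X := X) e.1 he' := by
  have h := Quiver.FreeGroupoid.lift_spec (graphInclusion T ⋙q Quiver.FreeGroupoid.of (Graph X))
  exact eq_of_heq (congr_arg_heq (fun ψ : Graph (T : SSet.{u}) ⥤q FundGroupoid X =>
    ψ.map (⟨e, he, rfl, rfl⟩ : @Quiver.Hom (Graph (T : SSet.{u})) _ _ _)) h)

variable {T}

/-- The tree reaches every vertex, so the paths can be chosen in `T`. The loop of an edge of `T` is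
then the image of a loop in the trivial fundamental group of `T`. -/
theorem exists_paths_label_eq_zero (hT : IsMaximalTree T) (x : X.obj (op (.mk 0))) :
    ∃ γ : ∀ a : FundGroupoid X, vert x ⟶ a, γ (vert x) = 𝟙 _ ∧
      ∀ (φ : FundGroup X x →* Multiplicative Z2.{u}), ∀ e ∈ T.obj (op (.mk 1)),
        label γ φ e = 0 := by
  have := hT.1.connected
  let i : X.obj (op (.mk 0)) → (T : SSet.{u}).obj (op (.mk 0)) := fun v => ⟨v, hT.2 v⟩
  let F := groupoidInclusion T
  obtain ⟨γ, hγ⟩ := exists_paths (T : SSet.{u}) (i x)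
  refine ⟨fun a => F.map (γ (vert (i (vertexAt a)))), ?_, fun φ e he => ?_⟩
  · exact (congrArg F.map hγ).trans (F.map_id _)
  · unfold label
    split_ifs with hn
    · have hn' : (⟨e, he⟩ : (T : SSet.{u}).obj (op (.mk 1))) ∈ (T : SSet.{u}).nonDegenerate 1 :=
        (SSet.nonDegenerate_iff_of_mono T.ι _).1 hn
      have h1 : loopOf γ (edgeClass _ hn') = 1 := (hT.1.trivial (i x)).elim _ _
      let γ₁ := F.map (γ (vert ((T : SSet.{u}).δ 1 ⟨e, he⟩)))
      let γ₀ := F.map (γ (vert ((T : SSet.{u}).δ 0 ⟨e, he⟩)))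
      have h2 : γ₁ ≫ F.map (edgeClass _ hn') ≫ Groupoid.inv γ₀ = 𝟙 _ := by
        have h3 := congrArg F.map h1
        rw [End.one_def, F.map_id] at h3
        rw [← h3, loopOf, F.map_comp, F.map_comp, Groupoid.inv_eq_inv, Groupoid.inv_eq_inv,
          F.map_inv]
      have h3 := groupoidInclusion_edgeClass T _ hn' hn
      refine (congrArg (fun g => (φ g).toAdd) (Eq.trans ?_ h2)).trans (congrArg _ (map_one φ))
      exact congrArg (fun g => γ₁ ≫ g ≫ Groupoid.inv γ₀) h3.symm
    · rfl

end Tree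

/-- The class of the cocycle is carried by the target of `π` and the coboundary by the deterministic
factor `coneAssign t`. On the target the cocycle is still no coboundary, since coboundaries pull
back to coboundaries. -/
theorem exists_eq_mul_of_factors {X Y : SSet.{u}} (π : X ⟶ Y) (hY : VertexConnected Y)
    (f : Y ⟶ NZ2.{u}) (hf : ¬ IsCoboundary (π ≫ f)) (t : X.obj (op (.mk 0)) → Z2.{u}) :
    ∃ p ∈ contextualVertices (cone Y), ∃ s : cone X ⟶ NZ2.{u},
      prDist (addCoboundary (π ≫ f) t) = mul (det s) (pullback (coneMap π) p) :=
  ⟨prDist f, prDist_mem_contextualVertices hY (not_isCoboundary_of_comp π hf), coneAssign t, by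
    rw [pullback_prDist, mul_det_prDist]⟩

end SimplicialDist

end

open SimplicialDist in
theorem mainTheorem4 (X : SSet.{u}) [X.HasDimensionLE 1] [X.IsConnected]
    (x : X.obj (op (SimplexCategory.mk 0))) :
    ((2 : ℕ∞) ^ numGenerators X x - 1) * 2 ^ (ENat.card (X.obj (op (SimplexCategory.mk 0))) - 1) ≤
        (contextualVertices (cone X)).encard ∧
      ∀ T : X.Subcomplex, IsMaximalTree T →
        ((2 : ℕ∞) ^ numGenerators X x - 1) *
            2 ^ (ENat.card (X.obj (op (SimplexCategory.mk 0))) - 1) ≤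
          {q ∈ contextualVertices (cone X) |
            ∃ p ∈ contextualVertices (cone (collapse T)), ∃ s : cone X ⟶ NZ2.{u},
              q = mul (det s) (pullback (coneMap (collapseMap T)) p)}.encard := by
  have hX := vertexConnected_of_isConnected X
  constructor
  · obtain ⟨γ, hγ⟩ := exists_paths X x
    exact le_encard_of_prDist_mem hγ fun φ hφ t => prDist_mem_contextualVertices hX
      (not_isCoboundary_addCoboundary (not_isCoboundary_assignOfHom hγ hφ) t)
  · intro T hT
    obtain ⟨γ, hγ, hlabel⟩ := exists_paths_label_eq_zero hT x
    refine le_encard_of_prDist_mem hγ fun φ hφ t => ?_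
    have hf := not_isCoboundary_assignOfHom hγ hφ
    refine ⟨prDist_mem_contextualVertices hX (not_isCoboundary_addCoboundary hf t), ?_⟩
    have h0 := ofCochain_eq_zero (label_of_degenerate γ φ) (hlabel φ)
    exact exists_eq_mul_of_factors (collapseMap T) (vertexConnected_collapse hX)
      -- The assignment is zero on `T`, hence constant there in each degree; its composite with
      -- `collapseMap T` is `assignOfHom γ φ` by definition.
      (collapseLift (assignOfHom γ φ) fun n a ha b hb => (h0 n a ha).trans (h0 n b hb).symm) hf t
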